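/- Let $d\in\{2,3\}$ and let $\Omega\subset\mathbb{R}^d$ be a bounded convex domain with polygonal or polyhedral boundary $\Gamma$ and outward unit normal $n$. Let $\|\cdot\|_{0,\Omega}$ be the $L^2(\Omega)$-norm (for scalar and for vector fields), let $$H(\operatorname{div},\Omega)=\{\tau\in L^2(\Omega)^d:\operatorname{div}\tau\in L^2(\Omega)\},\qquad \|\tau\|_{\operatorname{div},\Omega}^2=\|\tau\|_{0,\Omega}^2+\|\operatorname{div}\tau\|_{0,\Omega}^2,$$ with the divergence in the distributional sense, and let $H_0(\operatorname{div},\Omega)=\{\tau\in H(\operatorname{div},\Omega):\tau\cdot n=0\text{ on }\Gamma\}$, where $\tau\cdot n=0$ on $\Gamma$ means that $\int_\Omega(\tau\cdot\nabla w+w\operatorname{div}\tau)\,dx=0$ for all $w\in H^1(\Omega)$. Consider either of the following two choices of spaces $U$ and $\mathbf{M}$: - (simply supported boundary conditions) $U=L^2(\Omega)$ and $\mathbf{M}=H(\operatorname{div},\Omega)$; - (Cahn–Hilliard boundary conditions) $U=\{v\in L^2(\Omega):\int_\Omega v\,dx=0\}$ and $\mathbf{M}=H_0(\operatorname{div},\Omega)$.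 Put $$a((u,\sigma),(v,\tau))=\int_\Omega\operatorname{div}\sigma\,\operatorname{div}\tau\,dx,\qquad b((v,\tau),\psi)=\int_\Omega(\tau\cdot\psi+v\operatorname{div}\psi)\,dx,$$ $$\mathcal{V}=\{(v,\tau)\in U\times\mathbf{M}:\ b((v,\tau),\psi)=0\ \text{ for all }\psi\in\mathbf{M}\}.$$ Then, for each of the two kinds of boundary conditions, there exists a constant $C>0$ such that for all $(v,\tau)\in\mathcal{V}$ $$a((v,\tau),(v,\tau))\ \ge\ C\left(\|\tau\|_{\operatorname{div},\Omega}^2+\|v\|_{0,\Omega}^2\right).$$ -/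

import Mathlib

open MeasureTheory TopologicalSpace Distributions

namespace UltraWeak

/-- Euclidean space `ℝ^d`. -/
abbrev Space (d : ℕ) : Type := EuclideanSpace ℝ (Fin d)

/-- `Ω` (an open set) is a bounded convex domain with polygonal / polyhedral boundary, that is, the
interior of a convex polytope. -/
structure IsConvexPolyhedralDomain {d : ℕ} (Ω : Opens (Space d)) : Prop where
  nonempty : (Ω : Set (Space d)).Nonempty
  bounded : Bornology.IsBounded (Ω : Set (Space d))
  convex : Convex ℝ (Ω : Set (Space d))
  polyhedral : ∃ S : Set (Space d), S.Finite ∧ closure (Ω : Set (Space d)) = convexHull ℝ S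

/-- The two kinds of boundary conditions. -/
inductive BoundaryCondition
  | simplySupported
  | cahnHilliard

variable {d : ℕ}

/-- Lebesgue measure on `Ω`. -/
noncomputable abbrev vol (Ω : Opens (Space d)) : Measure (Space d) :=
  volume.restrict (Ω : Set (Space d))

/-- `L²(Ω)`; the norm `‖v‖` on it is `‖v‖_{0,Ω}`. -/
noncomputable abbrev L2 (Ω : Opens (Space d)) := Lp ℝ 2 (vol Ω)

/-- `L²(Ω)^d` with the norm `(∫ |τ|²)^{1/2}`. -/
noncomputable abbrev L2Vec (Ω : Opens (Space d)) := Lp (Space d) 2 (vol Ω)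

/-- `g` is the distributional divergence of `τ` on `Ω`: `∫ τ · ∇φ = - ∫ g φ` for all
`φ ∈ C_c^∞(Ω)`. -/
def HasWeakDiv {Ω : Opens (Space d)} (τ : L2Vec Ω) (g : L2 Ω) : Prop :=
  ∀ φ : 𝓓(Ω, ℝ),
    ∫ x in (Ω : Set (Space d)), inner ℝ (τ x) (gradient φ x)
      = - ∫ x in (Ω : Set (Space d)), g x * φ x

/-- `G` is the distributional gradient of `w` on `Ω`: `∫ w ∂ᵢφ = - ∫ Gᵢ φ` for all
`φ ∈ C_c^∞(Ω)` and all `i`. -/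
def HasWeakGrad {Ω : Opens (Space d)} (w : L2 Ω) (G : L2Vec Ω) : Prop :=
  ∀ (φ : 𝓓(Ω, ℝ)) (i : Fin d),
    ∫ x in (Ω : Set (Space d)), w x * (gradient φ x) i
      = - ∫ x in (Ω : Set (Space d)), (G x) i * φ x

section Facts

variable {Ω : Opens (Space d)}

theorem memLp_test (φ : 𝓓(Ω, ℝ)) : MemLp φ 2 (vol Ω) :=
  (φ.continuous.memLp_of_hasCompactSupport φ.hasCompactSupport).restrict _

theorem memLp_gradient (φ : 𝓓(Ω, ℝ)) : MemLp (gradient φ) 2 (vol Ω) := by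
  have hc : Continuous (gradient (φ : Space d → ℝ)) :=
    (InnerProductSpace.toDual ℝ (Space d)).symm.continuous.comp
      (φ.contDiff.continuous_fderiv (by simp))
  have hs : HasCompactSupport (gradient (φ : Space d → ℝ)) :=
    (φ.hasCompactSupport.fderiv ℝ).comp_left
      (g := (InnerProductSpace.toDual ℝ (Space d)).symm) (map_zero _)
  exact (hc.memLp_of_hasCompactSupport hs).restrict _

theorem integral_mul_eq_inner (v w : L2 Ω) :
    ∫ x in (Ω : Set (Space d)), v x * w x = inner ℝ v w := by
  rw [L2.inner_def]
  simp [mul_comm]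

theorem hasWeakDiv_iff (τ : L2Vec Ω) (g : L2 Ω) :
    HasWeakDiv τ g ↔ ∀ φ : 𝓓(Ω, ℝ),
      inner ℝ τ ((memLp_gradient φ).toLp (gradient φ)) = - inner ℝ g ((memLp_test φ).toLp φ) := by
  refine forall_congr' fun φ => ?_
  have h1 : ∫ x in (Ω : Set (Space d)), inner ℝ (τ x) (gradient φ x)
      = inner ℝ τ ((memLp_gradient φ).toLp (gradient φ)) := by
    rw [L2.inner_def]
    refine integral_congr_ae ?_
    filter_upwards [(memLp_gradient φ).coeFn_toLp] with x hx
    rw [hx]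
  have h2 : ∫ x in (Ω : Set (Space d)), g x * φ x = inner ℝ g ((memLp_test φ).toLp φ) := by
    rw [← integral_mul_eq_inner]
    refine integral_congr_ae ?_
    filter_upwards [(memLp_test φ).coeFn_toLp] with x hx
    rw [hx]
  rw [h1, h2]

/-- The weak divergence is unique. -/
theorem HasWeakDiv.unique {τ : L2Vec Ω} {g h : L2 Ω} (hg : HasWeakDiv τ g)
    (hh : HasWeakDiv τ h) : g = h := by
  rw [hasWeakDiv_iff] at hg hh
  have key : ∀ φ : 𝓓(Ω, ℝ), ∫ x in (Ω : Set (Space d)), φ x * (g - h) x = 0 := by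
    intro φ
    have h0 : inner ℝ (g - h) ((memLp_test φ).toLp φ) = 0 := by
      rw [inner_sub_left]
      linarith [hg φ, hh φ]
    rw [← h0, ← integral_mul_eq_inner]
    refine integral_congr_ae ?_
    filter_upwards [(memLp_test φ).coeFn_toLp] with x hx
    rw [hx, mul_comm]
  have hloc : LocallyIntegrableOn (g - h : L2 Ω) (Ω : Set (Space d)) volume := by
    have hm : MemLp (g - h : L2 Ω) 2 (vol Ω) := Lp.memLp _
    exact locallyIntegrableOn_of_locallyIntegrable_restrict (hm.locallyIntegrable (by norm_num))
  have hae := Ω.isOpen.ae_eq_zero_of_integral_contDiff_smul_eq_zero hloc ?_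
  · rw [← sub_eq_zero]
    refine Lp.ext ?_
    have h1 := (ae_restrict_iff' (μ := volume) Ω.isOpen.measurableSet).2 hae
    filter_upwards [h1, Lp.coeFn_zero ℝ 2 (vol Ω)] with x hx hx0
    rw [hx, hx0]
    rfl
  · intro φ h1 h2 h3
    have h4 := key ⟨φ, h1, h2, h3⟩
    rw [← h4]
    refine (setIntegral_eq_integral_of_forall_compl_eq_zero fun x hx => ?_).symm
    have : φ x = 0 := image_eq_zero_of_notMem_tsupport fun hx' => hx (h3 hx')
    simp [this]

end Facts

/-- `H(div, Ω)`: the fields in `L²(Ω)^d` whose distributional divergence is in `L²(Ω)`. -/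
def HDiv (Ω : Opens (Space d)) : Submodule ℝ (L2Vec Ω) where
  carrier := {τ | ∃ g : L2 Ω, HasWeakDiv τ g}
  zero_mem' := ⟨0, by rw [hasWeakDiv_iff]; simp⟩
  add_mem' := by
    rintro σ τ ⟨g, hg⟩ ⟨h, hh⟩
    refine ⟨g + h, ?_⟩
    rw [hasWeakDiv_iff] at *
    intro φ
    rw [inner_add_left, inner_add_left, hg φ, hh φ]
    ring
  smul_mem' := by
    rintro c τ ⟨g, hg⟩
    refine ⟨c • g, ?_⟩
    rw [hasWeakDiv_iff] at *
    intro φ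
    rw [real_inner_smul_left, real_inner_smul_left, hg φ]
    ring

/-- The divergence `div : H(div, Ω) → L²(Ω)`. -/
noncomputable def div {Ω : Opens (Space d)} (τ : HDiv Ω) : L2 Ω := τ.2.choose

theorem hasWeakDiv_div {Ω : Opens (Space d)} (τ : HDiv Ω) : HasWeakDiv (τ : L2Vec Ω) (div τ) :=
  τ.2.choose_spec

/-- `τ · n = 0` on `∂Ω`: the normal trace, i.e. the functional
`w ↦ ∫ τ · ∇w + ∫ (div τ) w` on (the traces of) `w ∈ H¹(Ω)`, vanishes. -/
def HasZeroNormalTrace {Ω : Opens (Space d)} (τ : HDiv Ω) : Prop :=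
  ∀ (w : L2 Ω) (G : L2Vec Ω), HasWeakGrad w G →
    ∫ x in (Ω : Set (Space d)), (inner ℝ ((τ : L2Vec Ω) x) (G x) + div τ x * w x) = 0

/-- The norm of `H(div, Ω)`: `‖τ‖_{div,Ω}² = ‖τ‖_{0,Ω}² + ‖div τ‖_{0,Ω}²`. -/
noncomputable def divNorm {Ω : Opens (Space d)} (τ : HDiv Ω) : ℝ :=
  Real.sqrt (‖(τ : L2Vec Ω)‖ ^ 2 + ‖div τ‖ ^ 2)

/-- The space `M`: `H(div, Ω)` for simply supported, `H₀(div, Ω)` for Cahn–Hilliard conditions. -/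
def spaceM (Ω : Opens (Space d)) : BoundaryCondition → Set (HDiv Ω)
  | .simplySupported => Set.univ
  | .cahnHilliard => {τ | HasZeroNormalTrace τ}

/-- The space `U`: `L²(Ω)` for simply supported conditions, its mean-zero functions for
Cahn–Hilliard conditions. -/
def spaceU (Ω : Opens (Space d)) : BoundaryCondition → Set (L2 Ω)
  | .simplySupported => Set.univ
  | .cahnHilliard => {v | ∫ x in (Ω : Set (Space d)), v x = 0}

/-- The space `𝕍 = U × M`. -/
def spaceV (Ω : Opens (Space d)) (bc : BoundaryCondition) : Set (L2 Ω × HDiv Ω) :=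
  spaceU Ω bc ×ˢ spaceM Ω bc

/-- `a((u,σ),(v,τ)) = ∫ div σ div τ`. -/
noncomputable def formA {Ω : Opens (Space d)} (p q : L2 Ω × HDiv Ω) : ℝ :=
  ∫ x in (Ω : Set (Space d)), div p.2 x * div q.2 x

/-- `b((v,τ),ψ) = ∫ (τ · ψ + v div ψ)`. -/
noncomputable def formB {Ω : Opens (Space d)} (p : L2 Ω × HDiv Ω) (ψ : HDiv Ω) : ℝ :=
  ∫ x in (Ω : Set (Space d)),
    (inner ℝ ((p.2 : L2Vec Ω) x) ((ψ : L2Vec Ω) x) + p.1 x * div ψ x)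

/-- The kernel space `𝒱 = {(v,τ) ∈ 𝕍 : b((v,τ),ψ) = 0 for all ψ ∈ M}`. -/
def kernelSpace (Ω : Opens (Space d)) (bc : BoundaryCondition) : Set (L2 Ω × HDiv Ω) :=
  {p | p ∈ spaceV Ω bc ∧ ∀ ψ ∈ spaceM Ω bc, formB p ψ = 0}

end UltraWeak

/-!
For `(v, τ)` in the kernel space, testing `b((v, τ), ·) = 0` with the compactly supported fields
`φ eᵢ`, which are admissible for both kinds of boundary conditions, shows that `τ` is the weak
gradient of `v` (`hasWeakGrad_of_mem_kernelSpace`). The Poincaré–Wirtinger inequality on the bounded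
convex domain `Ω` (`exists_norm_sub_const_le`) then bounds `v` by `τ` up to a constant function, and
that constant is controlled as well (`exists_abs_inner_const_le`): `v` has mean zero for
Cahn–Hilliard conditions, and for simply supported conditions testing with the field `x₀ e₀`, of
divergence `1`, gives `∫ v = -∫ τ · x₀ e₀`. Hence `‖v‖ ≤ C ‖τ‖`. Testing with `τ` itself gives
`‖τ‖² = -∫ v div τ ≤ C ‖τ‖ ‖div τ‖`, so `‖τ‖ ≤ C ‖div τ‖` and `‖v‖ ≤ C² ‖div τ‖`, while
`a((v, τ), (v, τ)) = ‖div τ‖²`.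

The Poincaré–Wirtinger inequality is proved for weak gradients in the form
`∫∫ |w x - w y|² ≤ K ∫ |G|²`. For smooth functions it follows by integrating the derivative along
segments and substituting in whichever endpoint has weight at least `1 / 2`
(`lintegral_lintegral_enorm_sub_sq_le`). A general `w` is mollified: on the convex set of points at
distance at least `2 r` from the complement of `Ω`, the gradient of the mollification at scale `r`
is the mollification of `G`, whose `L²` norm is at most that of `G`, and Fatou's lemma allows
`r → 0`.
-/

namespace UltraWeak

open Filter Set Metric
open scoped ENNReal Topology Convolution

/-! ### The Poincaré inequality for smooth functions on convex sets -/

theorem sq_lintegral_le_lintegral_sq {α : Type*} [MeasurableSpace α] (μ : Measure α)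
    [IsProbabilityMeasure μ] {g : α → ℝ≥0∞} (hg : AEMeasurable g μ) :
    (∫⁻ a, g a ∂μ) ^ 2 ≤ ∫⁻ a, g a ^ 2 ∂μ := by
  have h := ENNReal.lintegral_mul_le_Lp_mul_Lq μ Real.HolderConjugate.two_two
    (aemeasurable_const (b := (1 : ℝ≥0∞))) hg
  simp only [Pi.mul_apply, one_mul, ENNReal.one_rpow, lintegral_const, measure_univ] at h
  calc (∫⁻ a, g a ∂μ) ^ 2 ≤ ((∫⁻ a, g a ^ (2 : ℝ) ∂μ) ^ (1 / 2 : ℝ)) ^ 2 := by gcongr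
    _ = ∫⁻ a, g a ^ 2 ∂μ := by
      rw [← ENNReal.rpow_natCast, ← ENNReal.rpow_mul]
      norm_num

section Smooth

variable {E : Type*} [NormedAddCommGroup E] [NormedSpace ℝ E]

/-- The mean value inequality along a segment, in integrated and squared form. -/
theorem enorm_sub_sq_le_lintegral_segment {f : E → ℝ} (hf : ContDiff ℝ 1 f) (x y : E) :
    ‖f x - f y‖ₑ ^ 2 ≤
      ‖x - y‖ₑ ^ 2 * ∫⁻ t in Icc (0 : ℝ) 1, ‖fderiv ℝ f (t • x + (1 - t) • y)‖ₑ ^ 2 := by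
  have hγ : ∀ t : ℝ, HasDerivAt (fun t : ℝ => t • x + (1 - t) • y) (x - y) t := by
    intro t
    have h := ((hasDerivAt_id t).smul_const x).add
      (((hasDerivAt_id t).const_sub 1).smul_const y)
    have h' : (1 : ℝ) • x + (-1 : ℝ) • y = x - y := by module
    rw [h'] at h
    exact h
  have hderiv : ∀ t : ℝ, deriv (fun t : ℝ => f (t • x + (1 - t) • y)) t
      = fderiv ℝ f (t • x + (1 - t) • y) (x - y) := fun t =>
    (((hf.differentiable (by simp) _).hasFDerivAt).comp_hasDerivAt t (hγ t)).deriv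
  have hc : ContDiff ℝ 1 (fun t : ℝ => f (t • x + (1 - t) • y)) := by
    refine hf.comp ?_
    fun_prop
  have h1 := enorm_sub_le_lintegral_deriv_of_contDiffOn_Icc (a := 0) (b := 1) hc.contDiffOn
    zero_le_one
  have hcont : Continuous fun t : ℝ => fderiv ℝ f (t • x + (1 - t) • y) :=
    (hf.continuous_fderiv (by simp)).comp (by fun_prop)
  simp only [one_smul, sub_self, zero_smul, add_zero, sub_zero, zero_add, hderiv] at h1
  have : IsProbabilityMeasure (volume.restrict (Icc (0 : ℝ) 1)) := ⟨by simp⟩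
  calc ‖f x - f y‖ₑ ^ 2
      ≤ (∫⁻ t in Icc (0 : ℝ) 1, ‖x - y‖ₑ * ‖fderiv ℝ f (t • x + (1 - t) • y)‖ₑ) ^ 2 := by
        gcongr
        refine h1.trans (lintegral_mono fun t => ?_)
        rw [mul_comm]
        exact ContinuousLinearMap.le_opENorm _ _
    _ = ‖x - y‖ₑ ^ 2 * (∫⁻ t in Icc (0 : ℝ) 1, ‖fderiv ℝ f (t • x + (1 - t) • y)‖ₑ) ^ 2 := by
        rw [lintegral_const_mul _ hcont.enorm.measurable, mul_pow]
    _ ≤ _ := by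
        gcongr
        exact sq_lintegral_le_lintegral_sq _ hcont.enorm.aemeasurable

variable [FiniteDimensional ℝ E] [MeasurableSpace E] [BorelSpace E]
  (μ : Measure E) [μ.IsAddHaarMeasure]

theorem lintegral_comp_smul_add {g : E → ℝ≥0∞} (hg : Measurable g) {r : ℝ} (hr : r ≠ 0) (c : E) :
    ∫⁻ x, g (r • x + c) ∂μ
      = ENNReal.ofReal (abs (r ^ Module.finrank ℝ E)⁻¹) * ∫⁻ x, g x ∂μ := by
  have h := lintegral_map (μ := μ) (f := fun x => g (x + c)) (g := (r • · : E → E))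
    (hg.comp (measurable_add_const c)) (measurable_const_smul r)
  rw [← h, Measure.map_addHaar_smul μ hr, lintegral_smul_measure, lintegral_add_right_eq_self]
  rfl

/-- Averaging a function over the points of all segments at parameter `t` costs at most the
factor `2 ^ dim E`: substitute in the endpoint whose weight is at least `1 / 2`. -/
theorem lintegral_lintegral_comp_convexComb_le (A : Set E) {g : E → ℝ≥0∞} (hg : Measurable g)
    (t : ℝ) :
    ∫⁻ x in A, ∫⁻ y in A, g (t • x + (1 - t) • y) ∂μ ∂μ
      ≤ 2 ^ Module.finrank ℝ E * μ A * ∫⁻ z, g z ∂μ := by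
  have hconst : ∀ r : ℝ, 1 / 2 ≤ r →
      ENNReal.ofReal (abs (r ^ Module.finrank ℝ E)⁻¹) ≤ 2 ^ Module.finrank ℝ E := by
    intro r hr
    have h2 : (2 : ℝ≥0∞) ^ Module.finrank ℝ E
        = ENNReal.ofReal (2 ^ Module.finrank ℝ E) := by
      rw [ENNReal.ofReal_pow (by norm_num)]; simp
    rw [h2]
    apply ENNReal.ofReal_le_ofReal
    rw [abs_of_nonneg (by positivity), ← inv_pow]
    gcongr
    rw [inv_le_comm₀ (by linarith) (by norm_num)]
    linarith
  -- the bound when the second endpoint carries the weight `1 - s`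
  have key : ∀ s : ℝ, 1 / 2 ≤ 1 - s →
      ∫⁻ x in A, ∫⁻ y in A, g (s • x + (1 - s) • y) ∂μ ∂μ
        ≤ 2 ^ Module.finrank ℝ E * μ A * ∫⁻ z, g z ∂μ := by
    intro s hs
    calc ∫⁻ x in A, ∫⁻ y in A, g (s • x + (1 - s) • y) ∂μ ∂μ
        ≤ ∫⁻ x in A, 2 ^ Module.finrank ℝ E * ∫⁻ z, g z ∂μ ∂μ := by
          refine lintegral_mono fun x => ?_
          refine (setLIntegral_le_lintegral _ _).trans ?_
          simp_rw [add_comm (s • x)]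
          rw [lintegral_comp_smul_add μ hg (by linarith : (1 - s) ≠ 0)]
          gcongr
          exact hconst _ hs
      _ = _ := by
          rw [lintegral_const, Measure.restrict_apply_univ]
          ring
  rcases le_total t (1 / 2) with ht | ht
  · exact key t (by linarith)
  · rw [lintegral_lintegral_swap]
    · simpa [add_comm] using key (1 - t) (by linarith)
    · apply Measurable.aemeasurable
      exact hg.comp (by fun_prop)

/-- The Poincaré inequality in mean-difference form for a smooth function on a bounded convex
set. -/
theorem lintegral_lintegral_enorm_sub_sq_le {A : Set E} (hA : Convex ℝ A)
    (hAm : MeasurableSet A) {f : E → ℝ} (hf : ContDiff ℝ 1 f) :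
    ∫⁻ x in A, ∫⁻ y in A, ‖f x - f y‖ₑ ^ 2 ∂μ ∂μ
      ≤ ediam A ^ 2 * (2 ^ Module.finrank ℝ E * μ A) * ∫⁻ x in A, ‖fderiv ℝ f x‖ₑ ^ 2 ∂μ := by
  set g : E → ℝ≥0∞ := A.indicator fun x => ‖fderiv ℝ f x‖ₑ ^ 2 with hgdef
  have hg : Measurable g :=
    ((hf.continuous_fderiv (by simp)).enorm.measurable.pow_const 2).indicator hAm
  have hg3 : Measurable fun p : (E × E) × ℝ => g (p.2 • p.1.1 + (1 - p.2) • p.1.2) :=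
    hg.comp (by fun_prop)
  have hpt : ∀ x ∈ A, ∀ y ∈ A, ‖f x - f y‖ₑ ^ 2
      ≤ ediam A ^ 2 * ∫⁻ t in Icc (0 : ℝ) 1, g (t • x + (1 - t) • y) := by
    intro x hx y hy
    refine (enorm_sub_sq_le_lintegral_segment hf x y).trans ?_
    gcongr ?_ ^ 2 * ?_
    · rw [← edist_eq_enorm_sub]
      exact edist_le_ediam_of_mem hx hy
    · refine setLIntegral_mono' measurableSet_Icc fun t ht => ?_
      rw [hgdef, indicator_of_mem (hA hx hy ht.1 (by linarith [ht.2]) (by ring))]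
  calc ∫⁻ x in A, ∫⁻ y in A, ‖f x - f y‖ₑ ^ 2 ∂μ ∂μ
      ≤ ∫⁻ x in A, ∫⁻ y in A,
          (ediam A ^ 2 * ∫⁻ t in Icc (0 : ℝ) 1, g (t • x + (1 - t) • y)) ∂μ ∂μ :=
        setLIntegral_mono' hAm fun x hx => setLIntegral_mono' hAm fun y hy => hpt x hx y hy
    _ = ediam A ^ 2 * ∫⁻ x in A, ∫⁻ y in A, (∫⁻ t in Icc (0 : ℝ) 1,
          g (t • x + (1 - t) • y)) ∂μ ∂μ := by
        have hm : Measurable fun p : E × E =>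
            ∫⁻ t in Icc (0 : ℝ) 1, g (t • p.1 + (1 - t) • p.2) := hg3.lintegral_prod_right'
        rw [← lintegral_const_mul _ hm.lintegral_prod_right']
        refine lintegral_congr fun x => ?_
        exact lintegral_const_mul _ (hm.comp measurable_prodMk_left)
    _ = ediam A ^ 2 * ∫⁻ t in Icc (0 : ℝ) 1, ∫⁻ x in A, ∫⁻ y in A,
          g (t • x + (1 - t) • y) ∂μ ∂μ := by
        congr 1
        have h1 : ∀ x, ∫⁻ y in A, (∫⁻ t in Icc (0 : ℝ) 1, g (t • x + (1 - t) • y)) ∂μ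
            = ∫⁻ t in Icc (0 : ℝ) 1, ∫⁻ y in A, g (t • x + (1 - t) • y) ∂μ := by
          intro x
          refine lintegral_lintegral_swap (Measurable.aemeasurable ?_)
          exact hg.comp (by fun_prop)
        simp_rw [h1]
        refine lintegral_lintegral_swap (Measurable.aemeasurable ?_)
        have : Measurable fun q : (E × ℝ) × E => g (q.1.2 • q.1.1 + (1 - q.1.2) • q.2) :=
          hg.comp (by fun_prop)
        exact this.lintegral_prod_right'
    _ ≤ ediam A ^ 2 * ∫⁻ _t in Icc (0 : ℝ) 1,
          (2 ^ Module.finrank ℝ E * μ A * ∫⁻ z, g z ∂μ) := by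
        gcongr with t
        exact lintegral_lintegral_comp_convexComb_le μ A hg t
    _ = _ := by
        rw [lintegral_const, Measure.restrict_apply_univ, Real.volume_Icc, hgdef,
          lintegral_indicator hAm]
        simp [mul_assoc]

end Smooth

/-! ### Erosion of a set -/

/-- The points `x` with `ball x r ⊆ A`, that is, at distance at least `r` from the complement of
`A`. -/
def erosion {E : Type*} [PseudoMetricSpace E] (A : Set E) (r : ℝ) : Set E := {x | ball x r ⊆ A}

theorem isClosed_erosion {E : Type*} [PseudoMetricSpace E] (A : Set E) (r : ℝ) :
    IsClosed (erosion A r) := by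
  have h : erosion A r = (⋃ y ∈ Aᶜ, ball y r)ᶜ := by
    ext x
    simp only [erosion, mem_ofPred_eq, mem_compl_iff, mem_iUnion, not_exists, mem_ball]
    refine ⟨fun h y hy hxy => hy (h (mem_ball'.2 hxy)), fun h y hy => ?_⟩
    by_contra hyA
    exact h y hyA (mem_ball'.1 hy)
  rw [h]
  exact (isOpen_biUnion fun _ _ => isOpen_ball).isClosed_compl

theorem convex_erosion {E : Type*} [SeminormedAddCommGroup E] [NormedSpace ℝ E] {A : Set E}
    (hA : Convex ℝ A) (r : ℝ) : Convex ℝ (erosion A r) := by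
  intro x hx y hy a b ha hb hab z hz
  have hz' : z = a • (x + (z - (a • x + b • y))) + b • (y + (z - (a • x + b • y))) := by
    have : a • (z - (a • x + b • y)) + b • (z - (a • x + b • y)) = z - (a • x + b • y) := by
      rw [← add_smul, hab, one_smul]
    rw [smul_add, smul_add, add_add_add_comm, this]
    abel
  rw [mem_ball, dist_eq_norm] at hz
  rw [hz']
  exact hA (hx (by simpa [mem_ball, dist_eq_norm] using hz))
    (hy (by simpa [mem_ball, dist_eq_norm] using hz)) ha hb hab

theorem erosion_subset {E : Type*} [PseudoMetricSpace E] (A : Set E) {r : ℝ} (hr : 0 < r) :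
    erosion A r ⊆ A := fun _ hx => hx (mem_ball_self hr)

/-! ### Mollification of weak gradients -/

variable {d : ℕ} {Ω : Opens (Space d)}

/-- Testing the weak gradient with a derivative in an arbitrary direction. -/
theorem HasWeakGrad.integral_mul_fderiv {w : L2 Ω} {G : L2Vec Ω} (h : HasWeakGrad w G)
    (φ : 𝓓(Ω, ℝ)) (v : Space d) :
    ∫ x in (Ω : Set (Space d)), w x * fderiv ℝ φ x v
      = - ∫ x in (Ω : Set (Space d)), inner ℝ (G x) v * φ x := by
  have hgrad : ∀ i, MemLp (fun x => (gradient φ x) i) 2 (vol Ω) := fun i =>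
    (memLp_gradient φ).continuousLinearMap_comp (EuclideanSpace.proj (𝕜 := ℝ) i)
  have hG : ∀ i, MemLp (fun x => (G x) i) 2 (vol Ω) := fun i =>
    (Lp.memLp G).continuousLinearMap_comp (EuclideanSpace.proj (𝕜 := ℝ) i)
  have h1 : ∀ x, w x * fderiv ℝ φ x v = ∑ i, v i * (w x * (gradient φ x) i) := by
    intro x
    rw [← inner_gradient_left, PiLp.inner_apply, Finset.mul_sum]
    refine Finset.sum_congr rfl fun i _ => ?_
    simp only [RCLike.inner_apply, conj_trivial]
    ring
  have h2 : ∀ x, inner ℝ (G x) v * φ x = ∑ i, v i * ((G x) i * φ x) := by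
    intro x
    rw [PiLp.inner_apply, Finset.sum_mul]
    refine Finset.sum_congr rfl fun i _ => ?_
    simp only [RCLike.inner_apply, conj_trivial]
    ring
  simp_rw [h1, h2]
  have hi1 : ∀ i, Integrable (fun x => w x * (gradient φ x) i) (vol Ω) := fun i =>
    (Lp.memLp w).integrable_mul (hgrad i)
  have hi2 : ∀ i, Integrable (fun x => (G x) i * φ x) (vol Ω) := fun i =>
    (hG i).integrable_mul (memLp_test φ)
  rw [integral_finsetSum _ fun i _ => (hi1 i).const_mul _,
    integral_finsetSum _ fun i _ => (hi2 i).const_mul _, ← Finset.sum_neg_distrib]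
  refine Finset.sum_congr rfl fun i _ => ?_
  rw [integral_const_mul, integral_const_mul, h φ i, mul_neg]

/-- The mollification by a normalized bump function of `w`, extended by zero outside `Ω`. -/
noncomputable def mollify (φ : ContDiffBump (0 : Space d)) (w : L2 Ω) : Space d → ℝ :=
  φ.normed volume ⋆[ContinuousLinearMap.lsmul ℝ ℝ, volume] (Ω : Set (Space d)).indicator w

theorem mollify_eq (φ : ContDiffBump (0 : Space d)) (w : L2 Ω) :
    mollify φ w = (Ω : Set (Space d)).indicator w
      ⋆[(ContinuousLinearMap.lsmul ℝ ℝ).flip, volume] φ.normed volume :=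
  (convolution_flip _).symm

theorem locallyIntegrable_indicator (hΩ : Bornology.IsBounded (Ω : Set (Space d))) (w : L2 Ω) :
    LocallyIntegrable ((Ω : Set (Space d)).indicator w) := by
  have : IsFiniteMeasure (vol Ω) := ⟨by simpa using hΩ.measure_lt_top⟩
  have h : Integrable w (vol Ω) := (Lp.memLp w).integrable one_le_two
  exact ((integrable_indicator_iff Ω.isOpen.measurableSet).2 h).locallyIntegrable

theorem contDiff_mollify (hΩ : Bornology.IsBounded (Ω : Set (Space d)))
    (φ : ContDiffBump (0 : Space d)) (w : L2 Ω) : ContDiff ℝ 1 (mollify φ w) := by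
  rw [mollify_eq]
  exact φ.hasCompactSupport_normed.contDiff_convolution_right (n := 1) _
    (locallyIntegrable_indicator hΩ w) φ.contDiff_normed

/-- Where the mollifier only sees `Ω`, the derivative of the mollification is the mollification
of the weak gradient. -/
theorem fderiv_mollify_apply (hΩ : Bornology.IsBounded (Ω : Set (Space d)))
    (φ : ContDiffBump (0 : Space d)) {w : L2 Ω} {G : L2Vec Ω} (h : HasWeakGrad w G)
    {x : Space d} (hx : closedBall x φ.rOut ⊆ Ω) (v : Space d) :
    fderiv ℝ (mollify φ w) x v
      = ∫ t in (Ω : Set (Space d)), inner ℝ (G t) v * φ.normed volume (x - t) := by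
  have hρ : ContDiff ℝ 1 (φ.normed volume : Space d → ℝ) := φ.contDiff_normed (n := 1)
  have hd := φ.hasCompactSupport_normed.hasFDerivAt_convolution_right
    (μ := (volume : Measure (Space d))) (ContinuousLinearMap.lsmul ℝ ℝ).flip
    (locallyIntegrable_indicator hΩ w) hρ x
  have hts : tsupport (fun t => φ.normed volume (x - t)) ⊆ closedBall x φ.rOut := by
    refine closure_minimal (fun t ht => ?_) isClosed_closedBall
    have : x - t ∈ Function.support (φ.normed volume : Space d → ℝ) := ht
    rw [φ.support_normed_eq, mem_ball_zero_iff] at this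
    rw [mem_closedBall', dist_eq_norm]
    exact this.le
  set ψ : 𝓓(Ω, ℝ) := ⟨fun t => φ.normed volume (x - t),
    (φ.contDiff_normed (n := ⊤)).comp (contDiff_const.sub contDiff_id),
    HasCompactSupport.of_support_subset_isCompact (isCompact_closedBall x φ.rOut)
      ((subset_tsupport _).trans hts), hts.trans hx⟩ with hψ
  have hψd : ∀ t, fderiv ℝ ψ t v = - fderiv ℝ (φ.normed volume : Space d → ℝ) (x - t) v := by
    intro t
    have h1 : HasFDerivAt (fun t : Space d => x - t) (-ContinuousLinearMap.id ℝ (Space d)) t :=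
      (hasFDerivAt_id t).const_sub x
    have h2 := ((hρ.differentiable (by simp) (x - t)).hasFDerivAt).comp t h1
    have h3 : fderiv ℝ ψ t = _ := h2.fderiv
    rw [h3]
    simp
  rw [mollify_eq, hd.fderiv, convolution_precompR_apply _ (locallyIntegrable_indicator hΩ w)
    (φ.hasCompactSupport_normed.fderiv ℝ) (hρ.continuous_fderiv (by simp)), convolution_def]
  have h4 := h.integral_mul_fderiv ψ v
  simp_rw [hψd, mul_neg, integral_neg] at h4
  refine Eq.trans ?_ (neg_injective h4)
  rw [← integral_indicator Ω.isOpen.measurableSet]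
  refine integral_congr_ae (ae_of_all _ fun t => ?_)
  by_cases ht : t ∈ (Ω : Set (Space d)) <;> simp [ht, mul_comm]

theorem lintegral_ofReal_normed_sub (φ : ContDiffBump (0 : Space d)) (x : Space d) :
    ∫⁻ t, ENNReal.ofReal (φ.normed volume (x - t)) = 1 := by
  rw [lintegral_sub_left_eq_self (fun t => ENNReal.ofReal (φ.normed volume t)) x,
    ← ofReal_integral_eq_lintegral_ofReal φ.integrable_normed (ae_of_all _ φ.nonneg_normed),
    φ.integral_normed, ENNReal.ofReal_one]

/-- Jensen's inequality for the mollifier, which is a probability density, applied to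
`fderiv_mollify_apply`. -/
theorem enorm_fderiv_mollify_sq_le (hΩ : Bornology.IsBounded (Ω : Set (Space d)))
    (φ : ContDiffBump (0 : Space d)) {w : L2 Ω} {G : L2Vec Ω} (h : HasWeakGrad w G)
    {x : Space d} (hx : closedBall x φ.rOut ⊆ Ω) :
    ‖fderiv ℝ (mollify φ w) x‖ₑ ^ 2
      ≤ ∫⁻ t in (Ω : Set (Space d)), ENNReal.ofReal (φ.normed volume (x - t)) * ‖G t‖ₑ ^ 2 := by
  set ρ : Space d → ℝ≥0∞ := fun t => ENNReal.ofReal (φ.normed volume (x - t)) with hρ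
  have hρm : Measurable ρ := by
    have : Continuous fun t => φ.normed volume (x - t) := φ.continuous_normed.comp (by fun_prop)
    exact this.measurable.ennreal_ofReal
  set g : Space d → ℝ≥0∞ := (Ω : Set (Space d)).indicator fun t => ‖G t‖ₑ with hg
  have hgm : Measurable g := (Lp.stronglyMeasurable G).enorm.indicator Ω.isOpen.measurableSet
  have hprob : IsProbabilityMeasure (volume.withDensity ρ) :=
    ⟨by rw [withDensity_apply _ MeasurableSet.univ, setLIntegral_univ,
      lintegral_ofReal_normed_sub]⟩
  have hle : ‖fderiv ℝ (mollify φ w) x‖ₑ ≤ ∫⁻ t, g t ∂(volume.withDensity ρ) := by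
    refine ContinuousLinearMap.opENorm_le_bound _ fun v => ?_
    rw [fderiv_mollify_apply hΩ φ h hx, lintegral_withDensity_eq_lintegral_mul _ hρm hgm]
    refine (enorm_integral_le_lintegral_enorm _).trans ?_
    rw [← lintegral_mul_const _ (hρm.mul hgm), ← lintegral_indicator Ω.isOpen.measurableSet]
    refine lintegral_mono fun t => ?_
    by_cases ht : t ∈ (Ω : Set (Space d))
    · simp only [ht, indicator_of_mem, Pi.mul_apply, hρ, hg]
      rw [enorm_mul, Real.enorm_of_nonneg (φ.nonneg_normed _), mul_comm, mul_assoc]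
      gcongr
      rw [← ofReal_norm, ← ofReal_norm, ← ofReal_norm, ← ENNReal.ofReal_mul (norm_nonneg _)]
      exact ENNReal.ofReal_le_ofReal (norm_inner_le_norm _ _)
    · simp [ht]
  calc ‖fderiv ℝ (mollify φ w) x‖ₑ ^ 2 ≤ (∫⁻ t, g t ∂(volume.withDensity ρ)) ^ 2 := by gcongr
    _ ≤ ∫⁻ t, g t ^ 2 ∂(volume.withDensity ρ) := sq_lintegral_le_lintegral_sq _ hgm.aemeasurable
    _ = _ := by
      rw [lintegral_withDensity_eq_lintegral_mul _ hρm (hgm.pow_const 2),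
        ← lintegral_indicator Ω.isOpen.measurableSet]
      refine lintegral_congr fun t => ?_
      by_cases ht : t ∈ (Ω : Set (Space d)) <;> simp [ht, hg, hρ]

theorem lintegral_enorm_fderiv_mollify_sq_le (hΩ : Bornology.IsBounded (Ω : Set (Space d)))
    (φ : ContDiffBump (0 : Space d)) {w : L2 Ω} {G : L2Vec Ω} (h : HasWeakGrad w G)
    {A : Set (Space d)} (hA : ∀ x ∈ A, closedBall x φ.rOut ⊆ Ω) (hAm : MeasurableSet A) :
    ∫⁻ x in A, ‖fderiv ℝ (mollify φ w) x‖ₑ ^ 2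
      ≤ ∫⁻ t in (Ω : Set (Space d)), ‖G t‖ₑ ^ 2 := by
  have hm : Measurable fun t : Space d => ENNReal.ofReal (φ.normed volume t) :=
    φ.continuous_normed.measurable.ennreal_ofReal
  have hGm : Measurable fun t => ‖G t‖ₑ ^ 2 := (Lp.stronglyMeasurable G).enorm.pow_const 2
  calc ∫⁻ x in A, ‖fderiv ℝ (mollify φ w) x‖ₑ ^ 2
      ≤ ∫⁻ x in A, ∫⁻ t in (Ω : Set (Space d)),
          ENNReal.ofReal (φ.normed volume (x - t)) * ‖G t‖ₑ ^ 2 :=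
        setLIntegral_mono' hAm fun x hx => enorm_fderiv_mollify_sq_le hΩ φ h (hA x hx)
    _ ≤ ∫⁻ x, ∫⁻ t in (Ω : Set (Space d)),
          ENNReal.ofReal (φ.normed volume (x - t)) * ‖G t‖ₑ ^ 2 := setLIntegral_le_lintegral _ _
    _ = ∫⁻ t in (Ω : Set (Space d)), ∫⁻ x,
          ENNReal.ofReal (φ.normed volume (x - t)) * ‖G t‖ₑ ^ 2 := by
        refine lintegral_lintegral_swap (Measurable.aemeasurable ?_)
        exact (hm.comp (measurable_fst.sub measurable_snd)).mul (hGm.comp measurable_snd)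
    _ = _ := by
        refine lintegral_congr fun t => ?_
        have hmt : Measurable fun x => ENNReal.ofReal (φ.normed volume (x - t)) :=
          hm.comp (measurable_sub_const t)
        rw [lintegral_mul_const _ hmt,
          lintegral_sub_right_eq_self (fun x => ENNReal.ofReal (φ.normed volume x)) t]
        have := lintegral_ofReal_normed_sub φ (0 : Space d)
        simp only [zero_sub, φ.normed_neg] at this
        rw [this, one_mul]

/-- The Poincaré inequality in mean-difference form on a bounded convex domain. -/
theorem HasWeakGrad.lintegral_lintegral_enorm_sub_sq_le
    (hΩ : Bornology.IsBounded (Ω : Set (Space d))) (hc : Convex ℝ (Ω : Set (Space d)))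
    {w : L2 Ω} {G : L2Vec Ω} (h : HasWeakGrad w G) :
    ∫⁻ x in (Ω : Set (Space d)), ∫⁻ y in (Ω : Set (Space d)), ‖w x - w y‖ₑ ^ 2
      ≤ ediam (Ω : Set (Space d)) ^ 2 * (2 ^ d * volume (Ω : Set (Space d)))
        * ∫⁻ x in (Ω : Set (Space d)), ‖G x‖ₑ ^ 2 := by
  -- bump functions supported in the ball of radius `r n`, with `r n → 0`
  set r : ℕ → ℝ := fun n => 1 / ((n : ℝ) + 1) with hr
  have hr0 : ∀ n, 0 < r n := fun n => by positivity
  have hrlim : Tendsto r atTop (𝓝 0) := tendsto_one_div_add_atTop_nhds_zero_nat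
  set φ : ℕ → ContDiffBump (0 : Space d) := fun n =>
    ⟨r n / 2, r n, by linarith [hr0 n], by linarith [hr0 n]⟩ with hφ
  -- the factor `2` makes the closed ball of radius `r n` fit into the open ball
  set A : ℕ → Set (Space d) := fun n => erosion (Ω : Set (Space d)) (2 * r n) with hAdef
  have hAm : ∀ n, MeasurableSet (A n) := fun n => (isClosed_erosion _ _).measurableSet
  have hAΩ : ∀ n, A n ⊆ Ω := fun n => erosion_subset _ (by linarith [hr0 n])
  have hAball : ∀ n, ∀ x ∈ A n, closedBall x (φ n).rOut ⊆ Ω := fun n x hx =>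
    (closedBall_subset_ball (show r n < 2 * r n by linarith [hr0 n])).trans hx
  have hAev : ∀ x ∈ (Ω : Set (Space d)), ∀ᶠ n in atTop, x ∈ A n := by
    intro x hx
    obtain ⟨ε, hε, hball⟩ := Metric.isOpen_iff.1 Ω.isOpen x hx
    filter_upwards [hrlim.eventually_lt_const (half_pos hε)] with n hn
    exact (ball_subset_ball (by linarith)).trans hball
  set f : ℕ → Space d → ℝ := fun n => mollify (φ n) w with hf
  have hfc : ∀ n, ContDiff ℝ 1 (f n) := fun n => contDiff_mollify hΩ _ _
  have hae : ∀ᵐ x ∂(vol Ω), Tendsto (fun n => f n x) atTop (𝓝 (w x)) := by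
    rw [ae_restrict_iff' Ω.isOpen.measurableSet]
    filter_upwards [ContDiffBump.ae_convolution_tendsto_right_of_locallyIntegrable
      (φ := φ) (K := 2) hrlim (Eventually.of_forall fun n => by simp only [hφ]; linarith)
      (locallyIntegrable_indicator hΩ w)] with x hx hxΩ
    rw [indicator_of_mem hxΩ] at hx
    exact hx
  set F : ℕ → Space d × Space d → ℝ≥0∞ := fun n =>
    (A n ×ˢ A n).indicator fun p => ‖f n p.1 - f n p.2‖ₑ ^ 2 with hF
  have hFm' : ∀ n, Measurable fun p : Space d × Space d => ‖f n p.1 - f n p.2‖ₑ ^ 2 := by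
    intro n
    have : Continuous fun p : Space d × Space d => f n p.1 - f n p.2 :=
      ((hfc n).continuous.comp continuous_fst).sub ((hfc n).continuous.comp continuous_snd)
    exact this.enorm.measurable.pow_const 2
  have hFm : ∀ n, Measurable (F n) := fun n => (hFm' n).indicator ((hAm n).prod (hAm n))
  have hbound : ∀ n, ∫⁻ p, F n p ∂((vol Ω).prod (vol Ω))
      ≤ ediam (Ω : Set (Space d)) ^ 2 * (2 ^ d * volume (Ω : Set (Space d)))
        * ∫⁻ x in (Ω : Set (Space d)), ‖G x‖ₑ ^ 2 := by
    intro n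
    have h1 := UltraWeak.lintegral_lintegral_enorm_sub_sq_le volume
      (convex_erosion hc (2 * r n)) (hAm n) (hfc n)
    rw [finrank_euclideanSpace_fin] at h1
    calc ∫⁻ p, F n p ∂((vol Ω).prod (vol Ω))
        = ∫⁻ x in A n, ∫⁻ y in A n, ‖f n x - f n y‖ₑ ^ 2 := by
          rw [hF, lintegral_indicator ((hAm n).prod (hAm n)), ← Measure.prod_restrict,
            Measure.restrict_restrict (hAm n), inter_eq_left.2 (hAΩ n),
            lintegral_prod _ (hFm' n).aemeasurable]
      _ ≤ _ := h1
      _ ≤ _ := by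
          gcongr ?_ ^ 2 * (_ * ?_) * ?_
          · exact ediam_mono (hAΩ n)
          · exact measure_mono (hAΩ n)
          · exact lintegral_enorm_fderiv_mollify_sq_le hΩ (φ n) h (hAball n) (hAm n)
  have hlim : ∀ᵐ p ∂((vol Ω).prod (vol Ω)),
      ‖w p.1 - w p.2‖ₑ ^ 2 = liminf (fun n => F n p) atTop := by
    have hmem : ∀ᵐ x ∂(vol Ω), x ∈ (Ω : Set (Space d)) := ae_restrict_mem Ω.isOpen.measurableSet
    filter_upwards [Measure.quasiMeasurePreserving_fst.ae (hae.and hmem),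
      Measure.quasiMeasurePreserving_snd.ae (hae.and hmem)] with p hp1 hp2
    have ht : Tendsto (fun n => ‖f n p.1 - f n p.2‖ₑ ^ 2) atTop (𝓝 (‖w p.1 - w p.2‖ₑ ^ 2)) :=
      ((ENNReal.continuous_pow 2).tendsto _).comp
        ((continuous_enorm.tendsto _).comp (hp1.1.sub hp2.1))
    refine (Tendsto.liminf_eq (ht.congr' ?_)).symm
    filter_upwards [hAev _ hp1.2, hAev _ hp2.2] with n h1 h2
    exact (indicator_of_mem (show p ∈ A n ×ˢ A n from ⟨h1, h2⟩)
      fun p : Space d × Space d => ‖f n p.1 - f n p.2‖ₑ ^ 2).symm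
  have hwm : Measurable fun p : Space d × Space d => ‖w p.1 - w p.2‖ₑ ^ 2 :=
    (((Lp.stronglyMeasurable w).comp_measurable measurable_fst).sub
      ((Lp.stronglyMeasurable w).comp_measurable measurable_snd)).enorm.pow_const 2
  rw [← lintegral_prod (fun p : Space d × Space d => ‖w p.1 - w p.2‖ₑ ^ 2) hwm.aemeasurable,
    lintegral_congr_ae hlim]
  refine (lintegral_liminf_le hFm).trans ?_
  exact liminf_le_of_le (by isBoundedDefault)
    fun b hb => (hb.exists.choose_spec).trans (hbound _)

/-! ### The Poincaré–Wirtinger inequality -/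

theorem isFiniteMeasure_vol (hΩ : Bornology.IsBounded (Ω : Set (Space d))) :
    IsFiniteMeasure (vol Ω) := ⟨by simpa using hΩ.measure_lt_top⟩

theorem enorm_Lp_two_sq {α F : Type*} [MeasurableSpace α] {μ : Measure α} [NormedAddCommGroup F]
    (f : Lp F 2 μ) : ‖f‖ₑ ^ 2 = ∫⁻ x, ‖f x‖ₑ ^ 2 ∂μ := by
  rw [Lp.enorm_def, eLpNorm_eq_lintegral_rpow_enorm_toReal (by norm_num) (by norm_num),
    ← ENNReal.rpow_natCast, ← ENNReal.rpow_mul]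
  norm_num

/-- The Poincaré–Wirtinger inequality on a bounded convex domain. The constant `c` is a value
`w x` for which `∫ |w x - w y|² dy` is at most its average over `x`. -/
theorem exists_norm_sub_const_le (hΩ : Bornology.IsBounded (Ω : Set (Space d)))
    (hne : (Ω : Set (Space d)).Nonempty) (hc : Convex ℝ (Ω : Set (Space d)))
    [IsFiniteMeasure (vol Ω)] :
    ∃ C : ℝ, 0 ≤ C ∧ ∀ (w : L2 Ω) (G : L2Vec Ω), HasWeakGrad w G →
      ∃ c : ℝ, ‖w - c • Lp.const 2 (vol Ω) (1 : ℝ)‖ ≤ C * ‖G‖ := by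
  set K : ℝ≥0∞ := ediam (Ω : Set (Space d)) ^ 2 * 2 ^ d with hK
  have hKtop : K ≠ ∞ := ENNReal.mul_ne_top
    (ENNReal.pow_ne_top hΩ.ediam_ne_top) (ENNReal.pow_ne_top (by norm_num))
  have hV0 : volume (Ω : Set (Space d)) ≠ 0 := (Ω.isOpen.measure_pos _ hne).ne'
  have hVtop : volume (Ω : Set (Space d)) ≠ ∞ := hΩ.measure_lt_top.ne
  refine ⟨√K.toReal, Real.sqrt_nonneg _, fun w G h => ?_⟩
  have hm : Measurable fun p : Space d × Space d => ‖w p.1 - w p.2‖ₑ ^ 2 :=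
    (((Lp.stronglyMeasurable w).comp_measurable measurable_fst).sub
      ((Lp.stronglyMeasurable w).comp_measurable measurable_snd)).enorm.pow_const 2
  obtain ⟨x, -, hx⟩ := exists_le_setLAverage hV0 hVtop
    (f := fun x => ∫⁻ y in (Ω : Set (Space d)), ‖w x - w y‖ₑ ^ 2)
    hm.lintegral_prod_right'.aemeasurable
  refine ⟨w x, ?_⟩
  have h1 : ‖w - w x • Lp.const 2 (vol Ω) (1 : ℝ)‖ₑ ^ 2 ≤ K * ‖G‖ₑ ^ 2 := by
    rw [enorm_Lp_two_sq, enorm_Lp_two_sq]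
    calc ∫⁻ y in (Ω : Set (Space d)), ‖(w - w x • Lp.const 2 (vol Ω) (1 : ℝ) : L2 Ω) y‖ₑ ^ 2
        = ∫⁻ y in (Ω : Set (Space d)), ‖w x - w y‖ₑ ^ 2 := by
          refine lintegral_congr_ae ?_
          filter_upwards [Lp.coeFn_sub w (w x • Lp.const 2 (vol Ω) (1 : ℝ)),
            Lp.coeFn_smul (w x) (Lp.const 2 (vol Ω) (1 : ℝ)),
            Lp.coeFn_const (p := 2) (μ := vol Ω) (c := (1 : ℝ))] with y h1 h2 h3
          rw [h1, Pi.sub_apply, h2, Pi.smul_apply, h3, Function.const_apply, smul_eq_mul, mul_one,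
            ← edist_eq_enorm_sub, edist_comm, edist_eq_enorm_sub]
      _ ≤ (∫⁻ x in (Ω : Set (Space d)), ∫⁻ y in (Ω : Set (Space d)), ‖w x - w y‖ₑ ^ 2)
            / volume (Ω : Set (Space d)) := by rwa [setLAverage_eq] at hx
      _ ≤ (ediam (Ω : Set (Space d)) ^ 2 * (2 ^ d * volume (Ω : Set (Space d)))
            * ∫⁻ x in (Ω : Set (Space d)), ‖G x‖ₑ ^ 2) / volume (Ω : Set (Space d)) := by
          gcongr
          exact h.lintegral_lintegral_enorm_sub_sq_le hΩ hc
      _ = _ := by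
          rw [show ∀ a b c e : ℝ≥0∞, a * (b * c) * e = a * b * e * c by intros; ring,
            ENNReal.mul_div_cancel_right hV0 hVtop]
  have h2 : ‖w - w x • Lp.const 2 (vol Ω) (1 : ℝ)‖ ^ 2 ≤ K.toReal * ‖G‖ ^ 2 := by
    have := ENNReal.toReal_mono (ENNReal.mul_ne_top hKtop (by simp)) h1
    simpa using this
  rw [← Real.sqrt_sq (norm_nonneg G), ← Real.sqrt_mul ENNReal.toReal_nonneg]
  exact Real.le_sqrt_of_sq_le h2
  
/-- A vector that is close to the line through `e` and nearly orthogonal to `e` is small. -/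
theorem norm_le_of_norm_sub_smul_le {H : Type*} [NormedAddCommGroup H] [InnerProductSpace ℝ H]
    {e v : H} (he : e ≠ 0) {c a b : ℝ} (ha : ‖v - c • e‖ ≤ a) (hb : |inner ℝ v e| ≤ b) :
    ‖v‖ ≤ 2 * a + b / ‖e‖ := by
  have he' : 0 < ‖e‖ := norm_pos_iff.2 he
  have h1 : inner ℝ v e = inner ℝ (v - c • e) e + c * ‖e‖ ^ 2 := by
    rw [inner_sub_left, real_inner_smul_left, real_inner_self_eq_norm_sq]
    ring
  have h2 : |c| * ‖e‖ ^ 2 ≤ b + a * ‖e‖ := by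
    calc |c| * ‖e‖ ^ 2 = |inner ℝ v e - inner ℝ (v - c • e) e| := by
          rw [h1, add_sub_cancel_left, abs_mul, abs_of_nonneg (sq_nonneg ‖e‖)]
      _ ≤ |inner ℝ v e| + |inner ℝ (v - c • e) e| := abs_sub _ _
      _ ≤ b + ‖v - c • e‖ * ‖e‖ := add_le_add hb (abs_real_inner_le_norm _ _)
      _ ≤ _ := by gcongr
  have h3 : |c| * ‖e‖ ≤ b / ‖e‖ + a := by
    rw [div_add' _ _ _ he'.ne', le_div_iff₀ he']
    linarith
  calc ‖v‖ = ‖(v - c • e) + c • e‖ := by rw [sub_add_cancel]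
    _ ≤ ‖v - c • e‖ + |c| * ‖e‖ := by
      refine (norm_add_le _ _).trans_eq ?_
      rw [norm_smul, Real.norm_eq_abs]
    _ ≤ _ := by linarith

/-! ### Test fields in `H(div, Ω)` -/

/-- Integration by parts against a test function; no boundary term arises because the test function
has compact support in `Ω`. -/
theorem integral_mul_fderiv_test {f : Space d → ℝ} (hf : ContDiff ℝ 1 f) (φ : 𝓓(Ω, ℝ))
    (v : Space d) :
    ∫ x in (Ω : Set (Space d)), f x * fderiv ℝ φ x v
      = - ∫ x in (Ω : Set (Space d)), fderiv ℝ f x v * φ x := by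
  have hφ : ContDiff ℝ 1 φ := φ.contDiff.of_le (by simp)
  have hf' : Continuous fun x => fderiv ℝ f x v :=
    (hf.continuous_fderiv (by simp)).clm_apply continuous_const
  have hφ' : Continuous fun x => fderiv ℝ φ x v :=
    (hφ.continuous_fderiv (by simp)).clm_apply continuous_const
  have hsupp : HasCompactSupport fun x => fderiv ℝ φ x v := φ.hasCompactSupport.fderiv_apply ℝ v
  have hout : ∀ x, x ∉ (Ω : Set (Space d)) → x ∉ tsupport φ := fun x hx hx' =>
    hx (φ.tsupport_subset hx')
  rw [setIntegral_eq_integral_of_forall_compl_eq_zero,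
    setIntegral_eq_integral_of_forall_compl_eq_zero]
  · refine integral_mul_fderiv_eq_neg_fderiv_mul_of_integrable ?_ ?_ ?_
      (fun x _ => hf.differentiable (by simp) x) (fun x _ => hφ.differentiable (by simp) x)
    · exact (hf'.mul φ.continuous).integrable_of_hasCompactSupport φ.hasCompactSupport.mul_left
    · exact (hf.continuous.mul hφ').integrable_of_hasCompactSupport hsupp.mul_left
    · exact (hf.continuous.mul φ.continuous).integrable_of_hasCompactSupport
        φ.hasCompactSupport.mul_left
  · intro x hx
    rw [image_eq_zero_of_notMem_tsupport (hout x hx), mul_zero]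
  · intro x hx
    have : x ∉ tsupport (fderiv ℝ φ) := fun h => hout x hx (tsupport_fderiv_subset ℝ h)
    rw [image_eq_zero_of_notMem_tsupport this]
    simp

theorem memLp_vol_of_continuous (hΩ : Bornology.IsBounded (Ω : Set (Space d)))
    {F : Type*} [NormedAddCommGroup F] {f : Space d → F} (hf : Continuous f) : MemLp f 2 (vol Ω) := by
  have := isFiniteMeasure_vol hΩ
  obtain ⟨C, hC⟩ := hΩ.isCompact_closure.exists_bound_of_continuousOn hf.continuousOn
  refine MemLp.of_bound hf.aestronglyMeasurable C ?_
  filter_upwards [ae_restrict_mem Ω.isOpen.measurableSet] with x hx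
  exact hC x (subset_closure hx)

/-- The field `f eᵢ` for a `C¹` function `f` is in `H(div, Ω)`, and its divergence is `∂ᵢ f`. -/
theorem exists_hDiv_smul_single (hΩ : Bornology.IsBounded (Ω : Set (Space d)))
    {f : Space d → ℝ} (hf : ContDiff ℝ 1 f) (i : Fin d) :
    ∃ ψ : HDiv Ω,
      ((ψ : L2Vec Ω) =ᵐ[vol Ω] fun x => f x • EuclideanSpace.single i (1 : ℝ)) ∧
      (div ψ =ᵐ[vol Ω] fun x => fderiv ℝ f x (EuclideanSpace.single i 1)) := by
  have h1 : MemLp (fun x => f x • (EuclideanSpace.single i 1 : Space d)) 2 (vol Ω) :=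
    memLp_vol_of_continuous hΩ (hf.continuous.smul continuous_const)
  have h2 : MemLp (fun x => fderiv ℝ f x (EuclideanSpace.single i 1)) 2 (vol Ω) :=
    memLp_vol_of_continuous hΩ ((hf.continuous_fderiv (by simp)).clm_apply continuous_const)
  have hdiv : HasWeakDiv (h1.toLp _) (h2.toLp _) := by
    intro φ
    refine Eq.trans ?_ ((integral_mul_fderiv_test hf φ (EuclideanSpace.single i 1)).trans ?_)
    · refine integral_congr_ae ?_
      filter_upwards [h1.coeFn_toLp] with x hx
      rw [hx, real_inner_smul_left, real_inner_comm, inner_gradient_left]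
    · congr 1
      refine integral_congr_ae ?_
      filter_upwards [h2.coeFn_toLp] with x hx
      rw [hx]
  refine ⟨⟨h1.toLp _, _, hdiv⟩, h1.coeFn_toLp, ?_⟩
  rw [HasWeakDiv.unique (hasWeakDiv_div ⟨h1.toLp _, _, hdiv⟩) hdiv]
  exact h2.coeFn_toLp

theorem integral_inner_add_mul_eq (σ τ : L2Vec Ω) (v w : L2 Ω) :
    ∫ x in (Ω : Set (Space d)), (inner ℝ (σ x) (τ x) + v x * w x)
      = inner ℝ σ τ + inner ℝ v w := by
  have h : Integrable (fun x => v x * w x) (vol Ω) := (Lp.memLp v).integrable_mul (Lp.memLp w)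
  rw [integral_add (L2.integrable_inner σ τ) h,
    integral_mul_eq_inner, ← L2.inner_def]

theorem formB_eq (v : L2 Ω) (τ ψ : HDiv Ω) :
    formB (v, τ) ψ = inner ℝ (τ : L2Vec Ω) (ψ : L2Vec Ω) + inner ℝ v (div ψ) :=
  integral_inner_add_mul_eq _ _ _ _

theorem inner_smul_single_eq_integral {f : Space d → ℝ} {i : Fin d} {ψ : HDiv Ω}
    (hψ : (ψ : L2Vec Ω) =ᵐ[vol Ω] fun x => f x • EuclideanSpace.single i (1 : ℝ)) (G : L2Vec Ω) :
    inner ℝ (ψ : L2Vec Ω) G = ∫ x in (Ω : Set (Space d)), (G x) i * f x := by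
  rw [L2.inner_def]
  refine integral_congr_ae ?_
  filter_upwards [hψ] with x hx
  rw [hx, real_inner_smul_left, EuclideanSpace.inner_single_left]
  simp [mul_comm]

theorem inner_div_eq_integral {φ : Space d → ℝ} {i : Fin d} {ψ : HDiv Ω}
    (hψ : div ψ =ᵐ[vol Ω] fun x => fderiv ℝ φ x (EuclideanSpace.single i 1)) (w : L2 Ω) :
    inner ℝ w (div ψ) = ∫ x in (Ω : Set (Space d)), w x * (gradient φ x) i := by
  rw [← integral_mul_eq_inner]
  refine integral_congr_ae ?_
  filter_upwards [hψ] with x hx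
  rw [hx, ← inner_gradient_left, EuclideanSpace.inner_single_right]
  simp

/-! ### The kernel space -/

/-- The compactly supported fields `φ eᵢ` are admissible test fields for both kinds of boundary
conditions, so that `τ` is the weak gradient of `v` for `(v, τ)` in the kernel space. -/
theorem hasWeakGrad_of_mem_kernelSpace (hΩ : Bornology.IsBounded (Ω : Set (Space d)))
    {bc : BoundaryCondition} {v : L2 Ω} {τ : HDiv Ω} (h : (v, τ) ∈ kernelSpace Ω bc) :
    HasWeakGrad v (τ : L2Vec Ω) := by
  intro φ i
  obtain ⟨ψ, hψ, hψd⟩ := exists_hDiv_smul_single hΩ (φ.contDiff.of_le (by simp)) i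
  have hM : ψ ∈ spaceM Ω bc := by
    cases bc with
    | simplySupported => exact mem_univ _
    | cahnHilliard =>
      intro w G hG
      rw [integral_inner_add_mul_eq, real_inner_comm w, inner_smul_single_eq_integral hψ,
        inner_div_eq_integral hψd, hG φ i]
      ring
  have h0 := h.2 ψ hM
  rw [formB_eq, real_inner_comm, inner_smul_single_eq_integral hψ,
    inner_div_eq_integral hψd] at h0
  linarith

/-- For simply supported conditions the mean of `v` is controlled by the test field `x₀ e₀`, whose
divergence is `1`; for Cahn–Hilliard conditions it vanishes. -/
theorem exists_abs_inner_const_le (hd : 0 < d) (hΩ : Bornology.IsBounded (Ω : Set (Space d)))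
    [IsFiniteMeasure (vol Ω)] (bc : BoundaryCondition) :
    ∃ K : ℝ, 0 ≤ K ∧ ∀ (v : L2 Ω) (τ : HDiv Ω), (v, τ) ∈ kernelSpace Ω bc →
      |inner ℝ v (Lp.const 2 (vol Ω) (1 : ℝ))| ≤ K * ‖(τ : L2Vec Ω)‖ := by
  have hone : Lp.const 2 (vol Ω) (1 : ℝ) =ᵐ[vol Ω] fun _ => (1 : ℝ) := Lp.coeFn_const ..
  cases bc with
  | simplySupported =>
    obtain ⟨ψ, -, hψd⟩ := exists_hDiv_smul_single hΩ
      (ContinuousLinearMap.contDiff (EuclideanSpace.proj (𝕜 := ℝ) (⟨0, hd⟩ : Fin d))) ⟨0, hd⟩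
    have hdiv : div ψ = Lp.const 2 (vol Ω) (1 : ℝ) := by
      refine Lp.ext ?_
      filter_upwards [hψd, hone] with x h1 h2
      rw [h1, h2, ContinuousLinearMap.fderiv]
      simp
    refine ⟨‖(ψ : L2Vec Ω)‖, norm_nonneg _, fun v τ h => ?_⟩
    have h0 := h.2 ψ (mem_univ _)
    rw [formB_eq, hdiv, add_eq_zero_iff_neg_eq] at h0
    rw [← h0, abs_neg, mul_comm]
    exact abs_real_inner_le_norm _ _
  | cahnHilliard =>
    refine ⟨0, le_rfl, fun v τ h => ?_⟩
    have h0 : ∫ x in (Ω : Set (Space d)), v x = 0 := h.1.1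
    rw [← integral_mul_eq_inner]
    have h1 : ∫ x in (Ω : Set (Space d)), v x * Lp.const 2 (vol Ω) (1 : ℝ) x = 0 := by
      rw [← h0]
      refine integral_congr_ae ?_
      filter_upwards [hone] with x hx
      rw [hx, mul_one]
    rw [h1, abs_zero, zero_mul]

/-- The Poincaré–Friedrichs inequality on the kernel space, where `τ` is the weak gradient of
`v`. -/
theorem exists_norm_le_of_mem_kernelSpace (hd : 0 < d)
    (hΩ : Bornology.IsBounded (Ω : Set (Space d))) (hne : (Ω : Set (Space d)).Nonempty)
    (hc : Convex ℝ (Ω : Set (Space d))) (bc : BoundaryCondition) :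
    ∃ C : ℝ, 0 ≤ C ∧ ∀ (v : L2 Ω) (τ : HDiv Ω), (v, τ) ∈ kernelSpace Ω bc →
      ‖v‖ ≤ C * ‖(τ : L2Vec Ω)‖ := by
  have := isFiniteMeasure_vol hΩ
  obtain ⟨C, hC0, hC⟩ := exists_norm_sub_const_le hΩ hne hc
  obtain ⟨K, hK0, hK⟩ := exists_abs_inner_const_le hd hΩ bc
  have he : Lp.const 2 (vol Ω) (1 : ℝ) ≠ 0 := by
    have hV : vol Ω ≠ 0 := by
      rw [Ne, Measure.restrict_eq_zero]
      exact (Ω.isOpen.measure_pos _ hne).ne'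
    have : (ae (vol Ω)).NeBot := ae_neBot.2 hV
    intro h0
    have h1 : Lp.const 2 (vol Ω) (1 : ℝ) =ᵐ[vol Ω] fun _ => (1 : ℝ) := Lp.coeFn_const ..
    rw [h0] at h1
    obtain ⟨x, hx⟩ := (h1.symm.trans (Lp.coeFn_zero ℝ 2 (vol Ω))).exists
    exact one_ne_zero hx
  refine ⟨2 * C + K / ‖Lp.const 2 (vol Ω) (1 : ℝ)‖, by positivity, fun v τ h => ?_⟩
  obtain ⟨c, hc⟩ := hC v τ (hasWeakGrad_of_mem_kernelSpace hΩ h)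
  refine (norm_le_of_norm_sub_smul_le he hc (hK v τ h)).trans_eq ?_
  ring

end UltraWeak

theorem mainTheorem2 {d : ℕ} (hd : d = 2 ∨ d = 3)
    (Ω : TopologicalSpace.Opens (UltraWeak.Space d))
    (hΩ : UltraWeak.IsConvexPolyhedralDomain Ω) (bc : UltraWeak.BoundaryCondition) :
    ∃ C : ℝ, 0 < C ∧ ∀ (v : UltraWeak.L2 Ω) (τ : UltraWeak.HDiv Ω),
      (v, τ) ∈ UltraWeak.kernelSpace Ω bc →
        C * (UltraWeak.divNorm τ ^ 2 + ‖v‖ ^ 2) ≤ UltraWeak.formA (v, τ) (v, τ) := by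
  obtain ⟨C, hC0, hC⟩ := UltraWeak.exists_norm_le_of_mem_kernelSpace (by omega) hΩ.bounded
    hΩ.nonempty hΩ.convex bc
  -- `‖τ‖ ≤ C ‖div τ‖` and `‖v‖ ≤ C ^ 2 ‖div τ‖` contribute `C ^ 2` and `C ^ 4`
  refine ⟨(C ^ 2 + 1 + C ^ 4)⁻¹, by positivity, fun v τ h => ?_⟩
  have hv := hC v τ h
  -- testing with `τ` itself
  have h0 := h.2 τ h.1.2
  rw [UltraWeak.formB_eq, real_inner_self_eq_norm_sq] at h0
  have hA : UltraWeak.formA (v, τ) (v, τ) = ‖UltraWeak.div τ‖ ^ 2 :=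
    (UltraWeak.integral_mul_eq_inner _ _).trans (real_inner_self_eq_norm_sq _)
  have hD : UltraWeak.divNorm τ ^ 2
      = ‖(τ : UltraWeak.L2Vec Ω)‖ ^ 2 + ‖UltraWeak.div τ‖ ^ 2 := Real.sq_sqrt (by positivity)
  rw [hA, hD]
  set δ := ‖UltraWeak.div τ‖
  set t := ‖(τ : UltraWeak.L2Vec Ω)‖
  have ht0 : 0 ≤ t := norm_nonneg _
  have hδ0 : 0 ≤ δ := norm_nonneg _
  have h1 : t ^ 2 ≤ C * t * δ := by
    calc t ^ 2 = - inner ℝ v (UltraWeak.div τ) := by linarith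
      _ ≤ |inner ℝ v (UltraWeak.div τ)| := neg_le_abs _
      _ ≤ ‖v‖ * δ := abs_real_inner_le_norm _ _
      _ ≤ C * t * δ := by gcongr
  have ht : t ≤ C * δ := by
    rcases ht0.eq_or_lt with h2 | h2
    · rw [← h2]
      positivity
    · refine le_of_mul_le_mul_left ?_ h2
      linarith
  have hv' : ‖v‖ ≤ C ^ 2 * δ := by
    calc ‖v‖ ≤ C * t := hv
      _ ≤ C * (C * δ) := by gcongr
      _ = C ^ 2 * δ := by ring
  rw [inv_mul_le_iff₀ (by positivity)]
  calc t ^ 2 + δ ^ 2 + ‖v‖ ^ 2 ≤ (C * δ) ^ 2 + δ ^ 2 + (C ^ 2 * δ) ^ 2 := by gcongr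
    _ = _ := by ring
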